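/- All graphs are finite and simple. For a graph $G=(V,E)$, let $\alpha(G)$ be the maximum size of a stable (independent) set and $\mu(G)$ the maximum size of a matching. A vertex is pendant if it has exactly one neighbour, and an edge is pendant if one of its endpoints is a pendant vertex. $G$ is well-covered if every inclusion-maximal stable set has size $\alpha(G)$; very well-covered if moreover $|V|=2\alpha(G)$; a König–Egerváry graph if $\alpha(G)+\mu(G)=|V|$; $\alpha_0^+$-stable if no vertex belongs to all stable sets of size $\alpha(G)$; $\alpha^{++}$-stable if $\alpha(G+e_1+e_2)=\alpha(G)$ for any edges $e_1,e_2$ (not necessarily distinct) of the complement $\overline G$. **Proposition 3.9.** Let $G$ be a graph of girth at least $6$ (forests, having infinite girth, are included), no connected component of which is isomorphic to $C_7$ or $K_1$; for instance, a connected graph of girth at least $6$ that is isomorphic to neither $C_7$ nor $K_1$. Then the following assertions are equivalent: (i) $G$ is well-covered; (ii) $G$ has a perfect matching consisting of pendant edges; (iii) $G$ is very well-covered; (v) $G$ is a König–Egerváry $\alpha^{++}$-stable graph. If, moreover, no connected component of $G$ is isomorphic to $K_2$, then these assertions are also equivalent to: (iv) $G$ is a König–Egerváry $\alpha_0^+$-stable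 graph with exactly $\alpha(G)$ pendant vertices. Finally, if $G$ is not isomorphic to the path on three vertices, then in (v) it is enough to require $\alpha(G+e_1+e_2)=\alpha(G)$ for distinct $e_1,e_2\in E(\overline G)$; that is, (i) is then equivalent to $G$ being a König–Egerváry graph with this property. -/

import Mathlib

namespace SimpleGraph

variable {V : Type*} (G : SimpleGraph V)

/-- The matching number: the largest number of edges of a matching of `G`. -/
noncomputable def matchingNumber : ℕ :=
  sSup {n : ℕ | ∃ M : G.Subgraph, M.IsMatching ∧ M.edgeSet.ncard = n}

/-- A pendant vertex: a vertex with exactly one neighbour. -/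
def IsPendantVertex (v : V) : Prop :=
  (G.neighborSet v).ncard = 1

/-- A pendant edge: an edge with at least one pendant endpoint. -/
def IsPendantEdge (e : Sym2 V) : Prop :=
  e ∈ G.edgeSet ∧ ∃ v ∈ e, G.IsPendantVertex v

/-- `G` has a perfect matching all of whose edges are pendant edges of `G`. -/
def HasPendantPerfectMatching : Prop :=
  ∃ M : G.Subgraph, M.IsPerfectMatching ∧ ∀ e ∈ M.edgeSet, G.IsPendantEdge e

/-- Every (inclusion-)maximal stable set is a stable set of maximum size. -/
def IsWellCovered [Finite V] : Prop :=
  ∀ S : Finset V, Maximal G.IsIndepSet (S : Set V) → G.IsMaximumIndepSet S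

/-- Well-covered, with `|V| = 2 α(G)`. -/
def IsVeryWellCovered [Finite V] : Prop :=
  G.IsWellCovered ∧ Nat.card V = 2 * G.indepNum

/-- König–Egerváry graphs: `α(G) + μ(G) = |V|`. -/
def IsKonigEgervary : Prop :=
  G.indepNum + G.matchingNumber = Nat.card V

/-- `ξ(G)`: the number of vertices common to all the maximum stable sets. -/
noncomputable def xi [Finite V] : ℕ :=
  {v : V | ∀ S : Finset V, G.IsMaximumIndepSet S → v ∈ S}.ncard

/-- `α₀⁺`-stability: no vertex lies in all the maximum stable sets. -/
def IsAlphaZeroPlusStable [Finite V] : Prop :=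
  G.xi = 0

/-- `α⁺⁺`-stability: adding any `e₁, e₂` (possibly the same) from the edge set of the complement
does not change the stability number. -/
def IsAlphaPlusPlusStable : Prop :=
  ∀ e₁ ∈ Gᶜ.edgeSet, ∀ e₂ ∈ Gᶜ.edgeSet,
    (G ⊔ fromEdgeSet {e₁, e₂}).indepNum = G.indepNum

/-- The variant of `α⁺⁺`-stability in which only pairs of distinct edges of the complement
are added. -/
def IsAlphaPlusPlusStableDistinct : Prop :=
  ∀ e₁ ∈ Gᶜ.edgeSet, ∀ e₂ ∈ Gᶜ.edgeSet, e₁ ≠ e₂ →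
    (G ⊔ fromEdgeSet {e₁, e₂}).indepNum = G.indepNum

end SimpleGraph

/-! The heart is a local structure theorem: in a well-covered graph without cycles of length 3, 4 or
5, each vertex is isolated, lies on a component that is a 7-cycle, or belongs to a pendant edge
(`IsWellCoveredOn.isTame`). It is proved by induction on induced subgraphs. If there is a leaf, its
support can be deleted and the structure pulled back. If there is none, deleting closed
neighbourhoods shows that the degrees are at most 2 and that every nontrivial component closes up as
a 7-cycle. Once isolated vertices and 7-cycles are excluded, each support has a unique leaf, so
leaf-support pairs form a perfect matching, which is (i) → (ii).

Conversely, with a pendant perfect matching every maximal stable set meets each matching edge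
exactly once, so all have size |V|/2; this gives (iii) and the König–Egerváry property. Swapping
pendant vertices with their partners gives enough maximum stable sets for α⁺⁺-stability: an
obstruction would be a 4-cycle.

In a König–Egerváry graph every maximum stable set meets each edge of a maximum matching and misses
only matched vertices. Either stability condition makes that matching perfect. In (v), a matching
edge with no pendant end yields two non-edges that no maximum stable set can break together; in
(iv), counting pendant vertices puts exactly one on each matching edge. -/

namespace SimpleGraph

/-! ### Short cycles and girth -/

/-- `G` has no cycles of length three, four or five. -/
structure NoShortCycle {V : Type*} (G : SimpleGraph V) : Prop where
  no3 : ∀ {a b c : V}, G.Adj a b → G.Adj b c → G.Adj c a → False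
  no4 : ∀ {a b c d : V}, G.Adj a b → G.Adj b c → G.Adj c d → G.Adj d a → a ≠ c → b ≠ d → False
  no5 : ∀ {a b c d e : V}, G.Adj a b → G.Adj b c → G.Adj c d → G.Adj d e → G.Adj e a → False

theorem noShortCycle_of_egirth {V : Type*} {G : SimpleGraph V} (h : 6 ≤ G.egirth) :
    G.NoShortCycle := by
  rw [le_egirth] at h
  have h3 : ∀ {a b c : V}, G.Adj a b → G.Adj b c → G.Adj c a → False := by
    intro a b c hab hbc hca
    have := h a (.cons hab (.cons hbc (.cons hca .nil))) (by
      have := hab.ne; have := hbc.ne; have := hca.ne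
      simp [Walk.cons_isCycle_iff, Walk.cons_isPath_iff]
      grind)
    simp at this
    exact absurd this (by decide)
  refine ⟨h3, ?_, ?_⟩
  · intro a b c d hab hbc hcd hda hac hbd
    have := h a (.cons hab (.cons hbc (.cons hcd (.cons hda .nil)))) (by
      have := hab.ne; have := hbc.ne; have := hcd.ne; have := hda.ne
      simp [Walk.cons_isCycle_iff, Walk.cons_isPath_iff]
      grind)
    simp at this
    exact absurd this (by decide)
  · intro a b c d e hab hbc hcd hde hea
    have hac : a ≠ c := by rintro rfl; exact h3 hcd hde hea
    have hbd : b ≠ d := by rintro rfl; exact h3 hde hea hab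
    have hce : c ≠ e := by rintro rfl; exact h3 hea hab hbc
    have hda : d ≠ a := by rintro rfl; exact h3 hab hbc hcd
    have heb : e ≠ b := by rintro rfl; exact h3 hbc hcd hde
    have := h a (.cons hab (.cons hbc (.cons hcd (.cons hde (.cons hea .nil))))) (by
      have := hab.ne; have := hbc.ne; have := hcd.ne; have := hde.ne; have := hea.ne
      simp [Walk.cons_isCycle_iff, Walk.cons_isPath_iff]
      grind)
    simp at this
    exact absurd this (by decide)

/-! ### Well-coveredness of induced subgraphs -/

variable {V : Type*} {G : SimpleGraph V}

/-- `S` is a maximal stable set of the subgraph induced on `U`. -/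
def IsMaximalIndepOn (G : SimpleGraph V) (U S : Set V) : Prop :=
  S ⊆ U ∧ (∀ x ∈ S, ∀ y ∈ S, ¬ G.Adj x y) ∧ ∀ x ∈ U, x ∉ S → ∃ y ∈ S, G.Adj x y

/-- The subgraph induced on `U` is well-covered. -/
def IsWellCoveredOn (G : SimpleGraph V) (U : Set V) : Prop :=
  ∀ S T, G.IsMaximalIndepOn U S → G.IsMaximalIndepOn U T → S.ncard = T.ncard

/-- In the subgraph induced on `U`, the vertex `y` is the only neighbour of `x`. -/
def IsLeafOn (G : SimpleGraph V) (U : Set V) (x y : V) : Prop :=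
  x ∈ U ∧ y ∈ U ∧ G.Adj x y ∧ ∀ z ∈ U, G.Adj x z → z = y

/-- The closed neighbourhood of the set `I`. -/
def closedNbhd (G : SimpleGraph V) (I : Set V) : Set V :=
  {x | x ∈ I ∨ ∃ y ∈ I, G.Adj x y}

theorem exists_isMaximalIndepOn [Finite V] {U I : Set V} (hIU : I ⊆ U)
    (hI : ∀ x ∈ I, ∀ y ∈ I, ¬ G.Adj x y) : ∃ S, I ⊆ S ∧ G.IsMaximalIndepOn U S := by
  obtain ⟨S, hIS, hS⟩ := (Set.toFinite
    {S : Set V | S ⊆ U ∧ ∀ x ∈ S, ∀ y ∈ S, ¬ G.Adj x y}).exists_le_maximal (a := I) ⟨hIU, hI⟩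
  refine ⟨S, hIS, hS.prop.1, hS.prop.2, fun x hx hxS => ?_⟩
  by_contra! hcon
  have : insert x S ≤ S := by
    refine hS.le_of_ge ⟨Set.insert_subset hx hS.prop.1, ?_⟩ (Set.subset_insert x S)
    have := hS.prop.2
    rintro a (rfl | ha) b (rfl | hb)
    · exact G.irrefl
    · exact hcon b hb
    · exact fun h => hcon a ha h.symm
    · exact this a ha b hb
  exact hxS (this (Set.mem_insert x S))

theorem IsWellCoveredOn.ncard_le [Finite V] {U S I : Set V} (hU : G.IsWellCoveredOn U)
    (hS : G.IsMaximalIndepOn U S) (hIU : I ⊆ U) (hI : ∀ x ∈ I, ∀ y ∈ I, ¬ G.Adj x y) :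
    I.ncard ≤ S.ncard := by
  obtain ⟨T, hIT, hT⟩ := exists_isMaximalIndepOn hIU hI
  rw [hU S T hS hT]
  exact Set.ncard_le_ncard hIT

/-- Adding `I` turns maximal stable sets of the smaller graph into maximal stable sets of `U`, at
the constant cost |I|. -/
theorem IsWellCoveredOn.diff_closedNbhd [Finite V] {U I : Set V} (hU : G.IsWellCoveredOn U)
    (hIU : I ⊆ U) (hI : ∀ x ∈ I, ∀ y ∈ I, ¬ G.Adj x y) :
    G.IsWellCoveredOn (U \ G.closedNbhd I) := by
  have key : ∀ S, G.IsMaximalIndepOn (U \ G.closedNbhd I) S →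
      G.IsMaximalIndepOn U (S ∪ I) ∧ (S ∪ I).ncard = S.ncard + I.ncard := by
    rintro S ⟨hSU, hS, hmax⟩
    refine ⟨⟨Set.union_subset (fun x hx => (hSU hx).1) hIU, ?_, ?_⟩, Set.ncard_union_eq ?_⟩
    · rintro x (hx | hx) y (hy | hy) h
      · exact hS x hx y hy h
      · exact (hSU hx).2 (Or.inr ⟨y, hy, h⟩)
      · exact (hSU hy).2 (Or.inr ⟨x, hx, h.symm⟩)
      · exact hI x hx y hy h
    · intro x hx hxS
      simp only [Set.mem_union, not_or] at hxS
      by_cases hc : x ∈ G.closedNbhd I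
      · obtain hc | ⟨y, hy, h⟩ := hc
        · exact absurd hc hxS.2
        · exact ⟨y, Or.inr hy, h⟩
      · obtain ⟨y, hy, h⟩ := hmax x ⟨hx, hc⟩ hxS.1
        exact ⟨y, Or.inl hy, h⟩
    · rw [Set.disjoint_left]
      exact fun x hx hxI => (hSU hx).2 (Or.inl hxI)
  intro S T hS hT
  obtain ⟨h1, h2⟩ := key S hS
  obtain ⟨h3, h4⟩ := key T hT
  have := hU _ _ h1 h3
  omega

/-- Without `u` the leaf `l` is isolated, hence in every maximal stable set, which therefore still
dominates `u`. -/
theorem IsWellCoveredOn.diff_support {U : Set V} (hU : G.IsWellCoveredOn U) {l u : V}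
    (h : G.IsLeafOn U l u) : G.IsWellCoveredOn (U \ {u}) := by
  obtain ⟨hl, hu, hadj, huniq⟩ := h
  have key : ∀ S, G.IsMaximalIndepOn (U \ {u}) S → G.IsMaximalIndepOn U S := by
    rintro S ⟨hSU, hS, hmax⟩
    refine ⟨fun x hx => (hSU hx).1, hS, fun x hx hxS => ?_⟩
    by_cases hxu : x = u
    · subst hxu
      refine ⟨l, ?_, hadj.symm⟩
      by_contra hlS
      obtain ⟨y, hy, hly⟩ := hmax l ⟨hl, hadj.ne⟩ hlS
      exact (hSU hy).2 (huniq y (hSU hy).1 hly)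
    · exact hmax x ⟨hx, hxu⟩ hxS
  exact fun S T hS hT => hU S T (key S hS) (key T hT)

/-- Trading `u` for two leaves would enlarge a maximal stable set containing `u`. Most
contradictions below delete neighbourhoods until two leaves share a support. -/
theorem IsWellCoveredOn.leaf_unique [Finite V] {U : Set V} (hU : G.IsWellCoveredOn U) {a b u : V}
    (ha : G.IsLeafOn U a u) (hb : G.IsLeafOn U b u) : a = b := by
  by_contra hab
  obtain ⟨S, huS, hS⟩ := exists_isMaximalIndepOn (G := G) (U := U) (I := {u})
    (by simpa using ha.2.1) (by simp)
  simp only [Set.singleton_subset_iff] at huS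
  have haS : a ∉ S := fun h => hS.2.1 a h u huS ha.2.2.1
  have hbS : b ∉ S := fun h => hS.2.1 b h u huS hb.2.2.1
  have hle := hU.ncard_le hS (I := insert a (insert b (S \ {u}))) ?_ ?_
  · have h1 : (S \ {u}).ncard + 1 = S.ncard := Set.ncard_sdiff_singleton_add_one huS
    rw [Set.ncard_insert_of_notMem (by simp [hab, haS]),
      Set.ncard_insert_of_notMem (by simp [hbS])] at hle
    omega
  · refine Set.insert_subset ha.1 (Set.insert_subset hb.1 fun x hx => hS.1 hx.1)
  · have hal : ∀ z, (z = a ∨ z = b ∨ z ∈ S ∧ z ≠ u) → ¬ G.Adj a z ∧ ¬ G.Adj b z := by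
      rintro z hz
      have hzU : z ∈ U := by
        rcases hz with rfl | rfl | hz
        exacts [ha.1, hb.1, hS.1 hz.1]
      have hzu : z ≠ u := by
        rcases hz with rfl | rfl | hz
        exacts [ha.2.2.1.ne, hb.2.2.1.ne, hz.2]
      exact ⟨fun h => hzu (ha.2.2.2 z hzU h), fun h => hzu (hb.2.2.2 z hzU h)⟩
    intro x hx y hy h
    rcases hx with rfl | rfl | hx
    · exact (hal y hy).1 h
    · exact (hal y hy).2 h
    · rcases hy with rfl | rfl | hy
      · exact (hal x (Or.inr (Or.inr hx))).1 h.symm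
      · exact (hal x (Or.inr (Or.inr hx))).2 h.symm
      · exact hS.2.1 x hx.1 y hy.1 h

/-! ### Seven-cycle components -/

/-- The map `c` parametrizes a connected component of the subgraph induced on `U`
which is a cycle of length seven. -/
structure IsSevenCycleOn (G : SimpleGraph V) (U : Set V) (c : Fin 7 → V) : Prop where
  injective : Function.Injective c
  mem : ∀ i, c i ∈ U
  adj_iff : ∀ i, ∀ y ∈ U, G.Adj (c i) y ↔ y = c (i + 1) ∨ y = c (i - 1)

namespace IsSevenCycleOn

variable {U : Set V} {c : Fin 7 → V}

theorem adj_succ (hc : G.IsSevenCycleOn U c) (i : Fin 7) : G.Adj (c i) (c (i + 1)) :=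
  (hc.adj_iff i _ (hc.mem _)).2 (Or.inl rfl)

theorem adj_pred (hc : G.IsSevenCycleOn U c) (i : Fin 7) : G.Adj (c i) (c (i - 1)) :=
  (hc.adj_iff i _ (hc.mem _)).2 (Or.inr rfl)

theorem rotate (hc : G.IsSevenCycleOn U c) (k : Fin 7) :
    G.IsSevenCycleOn U (fun i => c (k + i)) where
  injective i j h := by simpa using hc.injective h
  mem i := hc.mem _
  adj_iff i y hy := by
    rw [hc.adj_iff _ y hy, add_assoc, add_sub_assoc]

theorem reflect (hc : G.IsSevenCycleOn U c) :
    G.IsSevenCycleOn U (fun i => c (-i)) where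
  injective i j h := by simpa using hc.injective h
  mem i := hc.mem _
  adj_iff i y hy := by
    rw [hc.adj_iff _ y hy, or_comm]
    have h1 : -i - 1 = -(i + 1) := by abel
    have h2 : -i + 1 = -(i - 1) := by abel
    rw [h1, h2]

theorem not_isLeafOn (hc : G.IsSevenCycleOn U c) (i : Fin 7) (y : V) :
    ¬ G.IsLeafOn U (c i) y := by
  rintro ⟨-, -, -, h⟩
  have h1 := h _ (hc.mem _) (hc.adj_succ i)
  have h2 := h _ (hc.mem _) (hc.adj_pred i)
  have hne : ∀ i : Fin 7, i + 1 ≠ i - 1 := by decide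
  exact hne i (hc.injective (h1.trans h2.symm))

end IsSevenCycleOn

/-! ### Induction step when a leaf exists -/

/-- The three possibilities for a vertex of a well-covered graph without short cycles. -/
def IsTame (G : SimpleGraph V) (U : Set V) (x : V) : Prop :=
  (∀ y ∈ U, ¬ G.Adj x y) ∨ (∃ c, G.IsSevenCycleOn U c ∧ ∃ i, c i = x) ∨
    ∃ y, G.IsLeafOn U x y ∨ G.IsLeafOn U y x

theorem mem_diff_closedNbhd_singleton {U : Set V} {v x : V} :
    x ∈ U \ G.closedNbhd {v} ↔ x ∈ U ∧ x ≠ v ∧ ¬ G.Adj x v := by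
  simp [closedNbhd]

theorem isTame_of_isLeafOn [Finite V] (hg : G.NoShortCycle) {U : Set V} (hU : G.IsWellCoveredOn U)
    {l u : V} (hl : G.IsLeafOn U l u) (ih : ∀ x ∈ U \ {u}, G.IsTame (U \ {u}) x) :
    ∀ x ∈ U, G.IsTame U x := by
  intro x hx
  by_cases hxu : x = u
  · subst hxu
    exact Or.inr (Or.inr ⟨l, Or.inr hl⟩)
  have hpair : ∀ h h', G.IsLeafOn (U \ {u}) h h' → G.IsLeafOn U h h' ∨ G.IsLeafOn U h' h := by
    rintro h h' ⟨hh, hh', hadj, huniq⟩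
    by_cases hu : G.Adj h u
    · right
      refine ⟨hh'.1, hh.1, hadj.symm, fun z hz hz' => ?_⟩
      by_contra hzh
      have hul : G.Adj u l := hl.2.2.1.symm
      have hlz : l ≠ z := by
        rintro rfl
        exact hh'.2 (hl.2.2.2 h' hh'.1 hz'.symm)
      have hlz' : ¬ G.Adj l z := by
        intro hlz'
        have := hl.2.2.2 z hz hlz'
        subst this
        exact hg.no3 hadj hz' hu.symm
      have hhz : ¬ G.Adj h z := fun h1 => hg.no3 hadj hz' h1.symm
      have huz : ¬ G.Adj u z := fun h1 => hg.no4 hu h1 hz'.symm hadj.symm (Ne.symm hzh) (Ne.symm hh'.2)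
      have huz' : u ≠ z := by
        rintro rfl
        exact hhz hu
      -- Deleting N[z] removes h' but keeps `l`, `h` and `u`, so `l` and `h` both become leaves at
      -- `u`.
      have hW := hU.diff_closedNbhd (I := {z}) (by simpa using hz) (by simp)
      have h1 : G.IsLeafOn (U \ G.closedNbhd {z}) l u := by
        refine ⟨mem_diff_closedNbhd_singleton.2 ⟨hl.1, hlz, hlz'⟩,
          mem_diff_closedNbhd_singleton.2 ⟨hl.2.1, huz', huz⟩, hl.2.2.1,
          fun y hy hly => hl.2.2.2 y hy.1 hly⟩
      have h2 : G.IsLeafOn (U \ G.closedNbhd {z}) h u := by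
        refine ⟨mem_diff_closedNbhd_singleton.2 ⟨hh.1, Ne.symm hzh, hhz⟩,
          mem_diff_closedNbhd_singleton.2 ⟨hl.2.1, huz', huz⟩, hu, fun y hy hhy => ?_⟩
        by_contra hyu
        have := huniq y ⟨hy.1, hyu⟩ hhy
        subst this
        exact (mem_diff_closedNbhd_singleton.1 hy).2.2 hz'
      have := hW.leaf_unique h1 h2
      subst this
      exact hh'.2 (hl.2.2.2 h' hh'.1 hadj)
    · left
      refine ⟨hh.1, hh'.1, hadj, fun z hz hz' => huniq z ⟨hz, ?_⟩ hz'⟩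
      rintro rfl
      exact hu hz'
  rcases ih x ⟨hx, hxu⟩ with h | ⟨c, hc, i, rfl⟩ | ⟨y, h | h⟩
  · by_cases hxu' : G.Adj x u
    · refine Or.inr (Or.inr ⟨u, Or.inl ⟨hx, hl.2.1, hxu', fun z hz hxz => ?_⟩⟩)
      by_contra hzu
      exact h z ⟨hz, hzu⟩ hxz
    · refine Or.inl fun y hy hxy => ?_
      by_cases hyu : y = u
      · exact hxu' (hyu ▸ hxy)
      · exact h y ⟨hy, hyu⟩ hxy
  · refine Or.inr (Or.inl ⟨c, ⟨hc.injective, fun i => (hc.mem i).1, fun j y hy => ?_⟩, i, rfl⟩)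
    by_cases hyu : y = u
    · subst hyu
      refine ⟨fun hadj => ?_, ?_⟩
      · exfalso
        have hd := hc.rotate j
        set d : Fin 7 → V := fun i => c (j + i) with hdd
        have hd0 : G.Adj (d 0) y := by simpa [hdd] using hadj
        have e01 : G.Adj (d 0) (d 1) := hd.adj_succ 0
        have e12 : G.Adj (d 1) (d 2) := hd.adj_succ 1
        have e06 : G.Adj (d 0) (d 6) := hd.adj_pred 0
        have e65 : G.Adj (d 6) (d 5) := hd.adj_pred 6
        have hne : ∀ a b : Fin 7, a ≠ b → d a ≠ d b := fun a b hab h => hab (hd.injective h)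
        have n2 : ¬ G.Adj y (d 2) := fun h =>
          hg.no4 hd0 h e12.symm e01.symm (hne _ _ (by decide)) (Ne.symm (hd.mem 1).2)
        have n5 : ¬ G.Adj y (d 5) := fun h =>
          hg.no4 hd0 h e65.symm e06.symm (hne _ _ (by decide)) (Ne.symm (hd.mem 6).2)
        have n52 : ¬ G.Adj (d 5) (d 2) := by
          rw [hd.adj_iff 5 _ (hd.mem 2), hd.injective.eq_iff, hd.injective.eq_iff]; decide
        have n02 : ¬ G.Adj (d 0) (d 2) := by
          rw [hd.adj_iff 0 _ (hd.mem 2), hd.injective.eq_iff, hd.injective.eq_iff]; decide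
        have n05 : ¬ G.Adj (d 0) (d 5) := by
          rw [hd.adj_iff 0 _ (hd.mem 5), hd.injective.eq_iff, hd.injective.eq_iff]; decide
        -- This deletes both cycle neighbours `d 1` and `d 6` of `d 0`, which becomes a second leaf
        -- at `y`.
        have hW := hU.diff_closedNbhd (I := {d 2, d 5}) (by
            rintro z (rfl | rfl)
            exacts [(hd.mem 2).1, (hd.mem 5).1]) (by
            rintro a (rfl | rfl) b (rfl | rfl)
            exacts [G.irrefl, fun h => n52 h.symm, n52, G.irrefl])
        have hmem : ∀ z, z ∈ U \ G.closedNbhd {d 2, d 5} ↔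
            z ∈ U ∧ z ≠ d 2 ∧ z ≠ d 5 ∧ ¬ G.Adj z (d 2) ∧ ¬ G.Adj z (d 5) := by
          intro z
          simp [closedNbhd]
          tauto
        have hyW : y ∈ U \ G.closedNbhd {d 2, d 5} :=
          (hmem y).2 ⟨hl.2.1, Ne.symm (hd.mem 2).2, Ne.symm (hd.mem 5).2, n2, n5⟩
        have hld : ∀ i, ¬ G.Adj l (d i) := fun i h => (hd.mem i).2 (hl.2.2.2 _ (hd.mem i).1 h)
        have hld' : ∀ i, l ≠ d i := by
          rintro i rfl
          exact hld _ (hd.adj_succ i)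
        have h1 : G.IsLeafOn (U \ G.closedNbhd {d 2, d 5}) l y :=
          ⟨(hmem l).2 ⟨hl.1, hld' _, hld' _, hld _, hld _⟩, hyW, hl.2.2.1,
            fun z hz hlz => hl.2.2.2 z hz.1 hlz⟩
        have h2 : G.IsLeafOn (U \ G.closedNbhd {d 2, d 5}) (d 0) y := by
          refine ⟨(hmem _).2 ⟨(hd.mem 0).1, hne _ _ (by decide), hne _ _ (by decide), n02, n05⟩,
            hyW, hd0, fun z hz h0z => ?_⟩
          by_contra hzy
          obtain ⟨hzU, -, -, hz2, hz5⟩ := (hmem z).1 hz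
          rcases (hd.adj_iff 0 z ⟨hzU, hzy⟩).1 h0z with rfl | rfl
          · exact hz2 e12
          · exact hz5 e65
        exact hld' 0 (hW.leaf_unique h1 h2)
      · rintro (h | h)
        · exact absurd h.symm (hc.mem _).2
        · exact absurd h.symm (hc.mem _).2
    · exact hc.adj_iff j y ⟨hy, hyu⟩
  · exact Or.inr (Or.inr ⟨y, hpair x y h⟩)
  · exact Or.inr (Or.inr ⟨y, (hpair y x h).symm⟩)

theorem IsSevenCycleOn.closed {U : Set V} {c : Fin 7 → V} (hc : G.IsSevenCycleOn U c)
    {i : Fin 7} {y : V} (hy : y ∈ U) (h : G.Adj (c i) y) : ∃ j, c j = y := by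
  rcases (hc.adj_iff i y hy).1 h with rfl | rfl
  exacts [⟨_, rfl⟩, ⟨_, rfl⟩]

theorem isSevenCycleOn_of_closed_walk (hg : G.NoShortCycle) {U : Set V} {c : Fin 7 → V}
    (hmem : ∀ i, c i ∈ U) (hadj : ∀ i, G.Adj (c i) (c (i + 1))) (hne : ∀ i, c i ≠ c (i + 2))
    (hdeg : ∀ x ∈ U, ∀ a ∈ U, ∀ b ∈ U, ∀ z ∈ U, G.Adj x a → G.Adj x b → G.Adj x z → a ≠ b →
      z = a ∨ z = b) : G.IsSevenCycleOn U c := by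
  have hne1 : ∀ i, c i ≠ c (i + 1) := fun i => (hadj i).ne
  have hne3 : ∀ i, c i ≠ c (i + 3) := by
    intro i h
    have h1 := hadj i
    have h2 := hadj (i + 1)
    have h3 := hadj (i + 2)
    rw [add_assoc] at h2 h3
    have e3 : (2 + 1 : Fin 7) = 3 := rfl
    have e2 : (1 + 1 : Fin 7) = 2 := rfl
    rw [e2] at h2
    rw [e3, ← h] at h3
    exact hg.no3 h1 h2 h3
  have hinj : Function.Injective c := by
    intro i j hij
    by_contra h
    -- Distinct positions are at cyclic distance at most 3; a coincidence at distance 3 would be a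
    -- triangle.
    have hcases : ∀ i j : Fin 7, i ≠ j → j = i + 1 ∨ j = i + 2 ∨ j = i + 3 ∨
        i = j + 1 ∨ i = j + 2 ∨ i = j + 3 := by decide
    rcases hcases i j h with rfl | rfl | rfl | rfl | rfl | rfl
    exacts [hne1 _ hij, hne _ hij, hne3 _ hij, hne1 _ hij.symm, hne _ hij.symm, hne3 _ hij.symm]
  refine ⟨hinj, hmem, fun i y hy => ?_⟩
  have hp : G.Adj (c i) (c (i - 1)) := by
    have := (hadj (i - 1)).symm
    rwa [sub_add_cancel] at this
  constructor
  · intro h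
    refine hdeg (c i) (hmem _) _ (hmem _) _ (hmem _) y hy (hadj i) hp h fun h => ?_
    have hd : ∀ i : Fin 7, i + 1 ≠ i - 1 := by decide
    exact hd i (hinj h)
  · rintro (rfl | rfl)
    exacts [hadj i, hp]

/-! ### Induction step when there is no leaf -/

section NoLeaf

variable {U : Set V}

/-- A neighbour, off the path, of the end of a path `v, u, w` is not in `N[v]`. -/
theorem mem_diff_of_adj_dist_two (hg : G.NoShortCycle) {v u w z : V} (hvu : G.Adj v u)
    (huw : G.Adj u w) (hwv : w ≠ v) (hz : z ∈ U) (hwz : G.Adj w z) (hzu : z ≠ u) :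
    z ∈ U \ G.closedNbhd {v} := by
  refine mem_diff_closedNbhd_singleton.2 ⟨hz, ?_, fun h => ?_⟩
  · rintro rfl
    exact hg.no3 hvu huw hwz
  · exact hg.no4 hvu huw hwz h (Ne.symm hwv) (Ne.symm hzu)

/-- A neighbour of `z` adjacent to `v` would close a 5-cycle; so `z` loses no neighbour when N[v] is
deleted. -/
theorem mem_diff_of_adj_dist_three (hg : G.NoShortCycle) {v u w z y : V} (hvu : G.Adj v u)
    (huw : G.Adj u w) (hwz : G.Adj w z) (hz : z ∈ U \ G.closedNbhd {v}) (hy : y ∈ U)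
    (hzy : G.Adj z y) : y ∈ U \ G.closedNbhd {v} := by
  refine mem_diff_closedNbhd_singleton.2 ⟨hy, ?_, fun h => hg.no5 hvu huw hwz hzy h⟩
  rintro rfl
  exact (mem_diff_closedNbhd_singleton.1 hz).2.2 hzy

theorem exists_other_adj (hnl : ∀ x y, ¬ G.IsLeafOn U x y) {x y : V} (hx : x ∈ U) (hy : y ∈ U)
    (hxy : G.Adj x y) : ∃ z ∈ U, G.Adj x z ∧ z ≠ y := by
  by_contra! h
  exact hnl x y ⟨hx, hy, hxy, h⟩

/-- A second neighbour of `w` survives the deletion, so `w` is not isolated. A leaf hanging at `w`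
would have kept all its neighbours and been a leaf already in `U`. -/
theorem isLeafOn_or_isSevenCycleOn (hg : G.NoShortCycle) (hnl : ∀ x y, ¬ G.IsLeafOn U x y)
    (ih : ∀ v ∈ U, ∀ x ∈ U \ G.closedNbhd {v}, G.IsTame (U \ G.closedNbhd {v}) x)
    {v u w : V} (hv : v ∈ U) (hu : u ∈ U) (hw : w ∈ U) (hvu : G.Adj v u) (huw : G.Adj u w)
    (hwv : w ≠ v) : (∃ y, G.IsLeafOn (U \ G.closedNbhd {v}) w y) ∨
      ∃ c, G.IsSevenCycleOn (U \ G.closedNbhd {v}) c ∧ c 0 = w := by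
  have hwD : w ∈ U \ G.closedNbhd {v} :=
    mem_diff_closedNbhd_singleton.2 ⟨hw, hwv, fun h => hg.no3 hvu huw h⟩
  rcases ih v hv w hwD with h | ⟨c, hc, i, rfl⟩ | ⟨y, h | h⟩
  · obtain ⟨z, hz, hwz, hzu⟩ := exists_other_adj hnl hw hu huw.symm
    exact absurd hwz (h z (mem_diff_of_adj_dist_two hg hvu huw hwv hz hwz hzu))
  · exact Or.inr ⟨_, hc.rotate i, by simp⟩
  · exact Or.inl ⟨y, h⟩
  · exfalso
    obtain ⟨z, hz, hyz, hzw⟩ := exists_other_adj hnl h.1.1 hw h.2.2.1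
    exact hzw (h.2.2.2 z (mem_diff_of_adj_dist_three hg hvu huw h.2.2.1.symm h.1 hz hyz) hyz)

/-- Deleting N[c 2] leaves `c 0` with neighbours `u` and `c 6`, so it lies on a new 7-cycle. That
cycle runs c 4, c 5, c 6, c 0, u, v, and its seventh vertex is the required `a`. -/
theorem exists_adj_adj_four (hg : G.NoShortCycle) (hnl : ∀ x y, ¬ G.IsLeafOn U x y)
    (ih : ∀ v ∈ U, ∀ x ∈ U \ G.closedNbhd {v}, G.IsTame (U \ G.closedNbhd {v}) x)
    {v u : V} (hv : v ∈ U) (hu : u ∈ U) {c : Fin 7 → V}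
    (hc : G.IsSevenCycleOn (U \ G.closedNbhd {v}) c) (hvu : G.Adj v u) (huw : G.Adj u (c 0)) :
    ∃ a, G.Adj v a ∧ G.Adj a (c 4) := by
  have hcm := fun i => mem_diff_closedNbhd_singleton.1 (hc.mem i)
  have hne : ∀ i j : Fin 7, i ≠ j → c i ≠ c j := fun i j hij h => hij (hc.injective h)
  have hucU : ∀ i, u ≠ c i := by
    rintro i rfl
    exact (hcm i).2.2 hvu.symm
  have e01 : G.Adj (c 0) (c 1) := hc.adj_succ 0
  have e12 : G.Adj (c 1) (c 2) := hc.adj_succ 1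
  have e06 : G.Adj (c 0) (c 6) := hc.adj_pred 0
  have e65 : G.Adj (c 6) (c 5) := hc.adj_pred 6
  have e54 : G.Adj (c 5) (c 4) := hc.adj_pred 5
  have huD : u ∈ U \ G.closedNbhd {c 2} := mem_diff_of_adj_dist_two hg e12.symm e01.symm
    (hne 0 2 (by decide)) hu huw.symm (hucU 1)
  have h6D : c 6 ∈ U \ G.closedNbhd {c 2} := mem_diff_of_adj_dist_two hg e12.symm e01.symm
    (hne 0 2 (by decide)) (hcm 6).1 e06 (hne 6 1 (by decide))
  have h5D : c 5 ∈ U \ G.closedNbhd {c 2} := by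
    refine mem_diff_closedNbhd_singleton.2 ⟨(hcm 5).1, hne 5 2 (by decide), ?_⟩
    rw [hc.adj_iff 5 _ (hc.mem 2), hc.injective.eq_iff, hc.injective.eq_iff]; decide
  have h4D : c 4 ∈ U \ G.closedNbhd {c 2} := by
    refine mem_diff_closedNbhd_singleton.2 ⟨(hcm 4).1, hne 4 2 (by decide), ?_⟩
    rw [hc.adj_iff 4 _ (hc.mem 2), hc.injective.eq_iff, hc.injective.eq_iff]; decide
  have hvD : v ∈ U \ G.closedNbhd {c 2} :=
    mem_diff_closedNbhd_singleton.2 ⟨hv, Ne.symm (hcm 2).2.1, fun h => (hcm 2).2.2 h.symm⟩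
  rcases isLeafOn_or_isSevenCycleOn hg hnl ih (hcm 2).1 (hcm 1).1 (hcm 0).1 e12.symm e01.symm
    (hne 0 2 (by decide)) with ⟨y, -, -, -, h⟩ | ⟨d, hd, hd0⟩
  · exact absurd ((h u huD huw.symm).trans (h _ h6D e06).symm) (hucU 6)
  have main : ∀ d, G.IsSevenCycleOn (U \ G.closedNbhd {c 2}) d → d 0 = c 0 → d 1 = u →
      d 6 = c 6 → ∃ a, G.Adj v a ∧ G.Adj a (c 4) := by
    intro d hd hd0 hd1 hd6
    have h5 : c 5 = d 5 := by
      rw [← hd6, hd.adj_iff 6 _ h5D] at e65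
      rcases e65 with h | h
      · exact absurd (h.trans hd0) (hne 5 0 (by decide))
      · exact h
    have h4 : c 4 = d 4 := by
      rw [h5, hd.adj_iff 5 _ h4D] at e54
      rcases e54 with h | h
      · exact absurd (h.trans hd6) (hne 4 6 (by decide))
      · exact h
    have h2 : v = d 2 := by
      have huv := hvu.symm
      rw [← hd1, hd.adj_iff 1 _ hvD] at huv
      rcases huv with h | h
      · exact h
      · exact absurd (h.trans hd0).symm (hcm 0).2.1
    refine ⟨d 3, ?_, ?_⟩
    · rw [h2]; exact hd.adj_succ 2
    · rw [h4]; exact hd.adj_succ 3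
  have hu' := (hd.adj_iff 0 _ huD).1 (hd0 ▸ huw.symm)
  have h6' := (hd.adj_iff 0 _ h6D).1 (hd0 ▸ e06)
  -- The new cycle may be traversed either way; `reflect` reduces to `d 1 = u`.
  rcases hu' with hu' | hu' <;> rcases h6' with h6' | h6'
  · exact absurd (hu'.trans h6'.symm) (hucU 6)
  · exact main d hd hd0 hu'.symm h6'.symm
  · exact main _ hd.reflect hd0 hu'.symm h6'.symm
  · exact absurd (hu'.trans h6'.symm) (hucU 6)

/-- If `w` were on a 7-cycle, both orientations would join `v` to `c 4` and to `c 3` by paths of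
length 2, closing a 5-cycle. -/
theorem exists_isLeafOn_of_dist_two (hg : G.NoShortCycle) (hnl : ∀ x y, ¬ G.IsLeafOn U x y)
    (ih : ∀ v ∈ U, ∀ x ∈ U \ G.closedNbhd {v}, G.IsTame (U \ G.closedNbhd {v}) x)
    {v u w : V} (hv : v ∈ U) (hu : u ∈ U) (hw : w ∈ U) (hvu : G.Adj v u) (huw : G.Adj u w)
    (hwv : w ≠ v) : ∃ y, G.IsLeafOn (U \ G.closedNbhd {v}) w y := by
  rcases isLeafOn_or_isSevenCycleOn hg hnl ih hv hu hw hvu huw hwv with h | ⟨c, hc, rfl⟩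
  · exact h
  obtain ⟨a, hva, ha⟩ := exists_adj_adj_four hg hnl ih hv hu hc hvu huw
  obtain ⟨b, hvb, hb⟩ := exists_adj_adj_four hg hnl ih hv hu hc.reflect hvu huw
  have e43 : G.Adj (c 4) (c 3) := hc.adj_pred 4
  exact (hg.no5 hva ha e43 hb.symm hvb.symm).elim

/-- Seen from a vertex `v` at distance two through `a`, the vertex `x` is a leaf after deleting
N[v], yet keeps all its neighbours other than `a`. -/
theorem degree_le_two_of_no_leaf (hg : G.NoShortCycle) (hnl : ∀ x y, ¬ G.IsLeafOn U x y)
    (ih : ∀ v ∈ U, ∀ x ∈ U \ G.closedNbhd {v}, G.IsTame (U \ G.closedNbhd {v}) x) :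
    ∀ x ∈ U, ∀ a ∈ U, ∀ b ∈ U, ∀ z ∈ U, G.Adj x a → G.Adj x b → G.Adj x z → a ≠ b →
      z = a ∨ z = b := by
  intro x hx a ha b hb z hz hxa hxb hxz hab
  by_contra! hcon
  obtain ⟨v, hv, hav, hvx⟩ := exists_other_adj hnl ha hx hxa.symm
  obtain ⟨y, -, -, -, h⟩ :=
    exists_isLeafOn_of_dist_two hg hnl ih hv ha hx hav.symm hxa.symm (Ne.symm hvx)
  have hbD := mem_diff_of_adj_dist_two hg hav.symm hxa.symm (Ne.symm hvx) hb hxb (Ne.symm hab)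
  have hzD := mem_diff_of_adj_dist_two hg hav.symm hxa.symm (Ne.symm hvx) hz hxz hcon.1
  exact hcon.2 ((h z hzD hxz).trans (h b hbD hxb).symm)

theorem isTame_of_no_leaf [Finite V] (hg : G.NoShortCycle) (hU : G.IsWellCoveredOn U)
    (hnl : ∀ x y, ¬ G.IsLeafOn U x y)
    (ih : ∀ v ∈ U, ∀ x ∈ U \ G.closedNbhd {v}, G.IsTame (U \ G.closedNbhd {v}) x)
    {v : V} (hv : v ∈ U) : G.IsTame U v := by
  by_cases hiso : ∀ y ∈ U, ¬ G.Adj v y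
  · exact Or.inl hiso
  push Not at hiso
  obtain ⟨u₁, hu₁, hvu₁⟩ := hiso
  obtain ⟨u₂, hu₂, hvu₂, hu⟩ := exists_other_adj hnl hv hu₁ hvu₁
  obtain ⟨w₁, hw₁, huw₁, hwv₁⟩ := exists_other_adj hnl hu₁ hv hvu₁.symm
  obtain ⟨w₂, hw₂, huw₂, hwv₂⟩ := exists_other_adj hnl hu₂ hv hvu₂.symm
  have hdeg := degree_le_two_of_no_leaf hg hnl ih
  obtain ⟨x₁, h₁⟩ := exists_isLeafOn_of_dist_two hg hnl ih hv hu₁ hw₁ hvu₁ huw₁ hwv₁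
  obtain ⟨x₂, h₂⟩ := exists_isLeafOn_of_dist_two hg hnl ih hv hu₂ hw₂ hvu₂ huw₂ hwv₂
  have hW := hU.diff_closedNbhd (I := {v}) (by simpa using hv) (by simp)
  have hww : ¬ G.Adj w₁ w₂ := fun h => hg.no5 hvu₁ huw₁ h huw₂.symm hvu₂.symm
  obtain ⟨y, hy, hxy, hyw⟩ := exists_other_adj hnl h₁.2.1.1 hw₁ h₁.2.2.1.symm
  have hyD := mem_diff_of_adj_dist_three hg hvu₁ huw₁ h₁.2.2.1 h₁.2.1 hy hxy
  -- The only viable case is that `y` supports a leaf `z` of the smaller graph. Its lost neighbour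
  -- is u₁ or u₂, so `z` is w₁ or w₂, and w₁ is attached to x₁.
  have hyx₂ : y = x₂ := by
    rcases ih v hv y hyD with h | ⟨c, hc, i, rfl⟩ | ⟨z, h | h⟩
    · exact absurd hxy.symm (h _ h₁.2.1)
    · obtain ⟨j, rfl⟩ := hc.closed h₁.2.1 hxy.symm
      obtain ⟨k, rfl⟩ := hc.closed h₁.1 h₁.2.2.1.symm
      exact absurd h₁ (hc.not_isLeafOn k _)
    · have hzx := h.2.2.2 x₁ h₁.2.1 hxy.symm
      subst hzx
      exact absurd (hW.leaf_unique h h₁) hyw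
    · obtain ⟨z', hz', hzz', hzy⟩ := exists_other_adj hnl h.1.1 hy h.2.2.1
      obtain ⟨hzU, hzv, hzv'⟩ := mem_diff_closedNbhd_singleton.1 h.1
      have hz'v : G.Adj z' v := by
        by_contra hcon
        refine hzy (h.2.2.2 z' (mem_diff_closedNbhd_singleton.2 ⟨hz', ?_, hcon⟩) hzz')
        rintro rfl
        exact hzv' hzz'
      rcases hdeg v hv u₁ hu₁ u₂ hu₂ z' hz' hvu₁ hvu₂ hz'v.symm (Ne.symm hu) with rfl | rfl
      · rcases hdeg _ hz' v hv w₁ hw₁ z hzU hvu₁.symm huw₁ hzz'.symm (Ne.symm hwv₁) with rfl | rfl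
        · exact absurd rfl hzv
        · exact absurd (h₁.2.2.2 y hyD h.2.2.1) hxy.ne'
      · rcases hdeg _ hz' v hv w₂ hw₂ z hzU hvu₂.symm huw₂ hzz'.symm (Ne.symm hwv₂) with rfl | rfl
        · exact absurd rfl hzv
        · exact h₂.2.2.2 y hyD h.2.2.1
  subst hyx₂
  have hD₁ := mem_diff_closedNbhd_singleton.1 h₁.2.1
  have hD₂ := mem_diff_closedNbhd_singleton.1 h₂.2.1
  refine Or.inr (Or.inl ⟨![v, u₁, w₁, x₁, y, w₂, u₂],
    isSevenCycleOn_of_closed_walk hg ?_ ?_ ?_ hdeg, 0, rfl⟩)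
  · intro i
    fin_cases i
    exacts [hv, hu₁, hw₁, hD₁.1, hy, hw₂, hu₂]
  · intro i
    fin_cases i
    exacts [hvu₁, huw₁, h₁.2.2.1, hxy, h₂.2.2.1.symm, huw₂.symm, hvu₂.symm]
  · intro i
    fin_cases i
    · exact Ne.symm hwv₁
    · rintro (rfl : u₁ = x₁)
      exact hD₁.2.2 hvu₁.symm
    · exact Ne.symm hyw
    · rintro (rfl : x₁ = w₂)
      exact hww h₁.2.2.1
    · rintro (rfl : y = u₂)
      exact hD₂.2.2 hvu₂.symm
    · exact hwv₂
    · exact hu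

end NoLeaf

theorem IsWellCoveredOn.isTame [Finite V] (hg : G.NoShortCycle) {U : Set V}
    (hU : G.IsWellCoveredOn U) : ∀ x ∈ U, G.IsTame U x := by
  induction hn : U.ncard using Nat.strong_induction_on generalizing U with
  | _ n ih =>
    by_cases hl : ∃ l u, G.IsLeafOn U l u
    · obtain ⟨l, u, hl⟩ := hl
      refine isTame_of_isLeafOn hg hU hl (ih _ ?_ (hU.diff_support hl) rfl)
      rw [← hn]
      exact Set.ncard_sdiff_singleton_lt_of_mem hl.2.1
    · push Not at hl
      intro x hx
      refine isTame_of_no_leaf hg hU hl (fun v hv => ih _ ?_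
        (hU.diff_closedNbhd (I := {v}) (by simpa using hv) (by simp)) rfl) hx
      rw [← hn]
      refine Set.ncard_lt_ncard ⟨Set.sdiff_subset, fun h => ?_⟩
      exact (h hv).2 (Or.inl rfl)

/-! ### Recognising components; from well-covered to a pendant perfect matching -/

theorem exists_connectedComponent_iso {W : Type*} {H : SimpleGraph W} (hH : H.Connected)
    (f : W → V) (hinj : Function.Injective f) (hadj : ∀ a b, G.Adj (f a) (f b) ↔ H.Adj a b)
    (hclosed : ∀ a y, G.Adj (f a) y → ∃ b, f b = y) :
    ∃ c : G.ConnectedComponent, Nonempty (c.toSimpleGraph ≃g H) := by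
  obtain ⟨w⟩ := hH.nonempty
  have hmem : ∀ a, f a ∈ (G.connectedComponentMk (f w)).supp := by
    intro a
    rw [ConnectedComponent.mem_supp_iff, ConnectedComponent.eq]
    let φ : H →g G := ⟨f, fun h => (hadj _ _).2 h⟩
    exact (hH.preconnected a w).map φ
  have hwalk : ∀ a y, G.Walk (f a) y → ∃ b, f b = y := by
    intro a y p
    generalize hx : f a = x at p
    induction p generalizing a with
    | nil => exact ⟨a, hx⟩
    | cons h p ih =>
      subst hx
      obtain ⟨b, hb⟩ := hclosed a _ h
      exact ih b hb
  refine ⟨G.connectedComponentMk (f w),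
    ⟨Iso.symm ⟨Equiv.ofBijective (fun a => ⟨f a, hmem a⟩) ⟨?_, ?_⟩, ?_⟩⟩⟩
  · intro a b h
    exact hinj (congrArg Subtype.val h)
  · rintro ⟨y, hy⟩
    obtain ⟨p⟩ := (ConnectedComponent.exact hy).symm
    obtain ⟨b, hb⟩ := hwalk w y p
    exact ⟨b, Subtype.ext hb⟩
  · intro a b
    exact hadj a b

theorem exists_iso_fin_one_of_isolated {x : V} (hx : ∀ y, ¬ G.Adj x y) :
    ∃ c : G.ConnectedComponent, Nonempty (c.toSimpleGraph ≃g (⊤ : SimpleGraph (Fin 1))) :=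
  exists_connectedComponent_iso connected_top (fun _ => x) (Function.injective_of_subsingleton _)
    (by simp) (fun _ y h => absurd h (hx y))

theorem exists_iso_cycleGraph_seven {c : Fin 7 → V} (hc : G.IsSevenCycleOn Set.univ c) :
    ∃ C : G.ConnectedComponent, Nonempty (C.toSimpleGraph ≃g cycleGraph 7) := by
  refine exists_connectedComponent_iso cycleGraph_connected c hc.injective (fun a b => ?_)
    (fun a y h => hc.closed (Set.mem_univ y) h)
  rw [hc.adj_iff a _ (Set.mem_univ _), hc.injective.eq_iff, hc.injective.eq_iff, cycleGraph_adj]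
  revert a b
  decide

theorem exists_iso_fin_two {x y : V} (hx : G.IsLeafOn Set.univ x y)
    (hy : G.IsLeafOn Set.univ y x) :
    ∃ c : G.ConnectedComponent, Nonempty (c.toSimpleGraph ≃g (⊤ : SimpleGraph (Fin 2))) := by
  refine exists_connectedComponent_iso connected_top ![x, y] ?_ ?_ ?_
  · intro a b
    have := hx.2.2.1.ne
    fin_cases a <;> fin_cases b <;> simp [this, this.symm]
  · intro a b
    have := hx.2.2.1
    fin_cases a <;> fin_cases b <;> simp [this, this.symm]
  · intro a z h
    fin_cases a
    · exact ⟨1, (hx.2.2.2 z (Set.mem_univ z) h).symm⟩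
    · exact ⟨0, (hy.2.2.2 z (Set.mem_univ z) h).symm⟩

theorem isPendantVertex_iff {v : V} :
    G.IsPendantVertex v ↔ ∃ y, G.IsLeafOn Set.univ v y := by
  rw [IsPendantVertex, Set.ncard_eq_one]
  refine exists_congr fun y => ⟨fun h => ?_, fun h => ?_⟩
  · refine ⟨trivial, trivial, ?_, fun z _ hz => ?_⟩
    · have : y ∈ G.neighborSet v := by rw [h]; rfl
      exact this
    · have : z ∈ G.neighborSet v := hz
      rw [h] at this
      exact this
  · ext z
    refine ⟨fun hz => h.2.2.2 z trivial hz, ?_⟩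
    rintro rfl
    exact h.2.2.1

theorem isMaximalIndepOn_univ_iff {S : Set V} :
    G.IsMaximalIndepOn Set.univ S ↔ Maximal G.IsIndepSet S := by
  rw [isMaximalIndepSet_iff]
  constructor
  · rintro ⟨-, hS, hmax⟩
    refine ⟨fun x hx y hy _ => hS x hx y hy, fun T hT hST x hx => ?_⟩
    by_contra hxS
    obtain ⟨y, hy, hxy⟩ := hmax x trivial hxS
    exact hT hx (hST hy) hxy.ne hxy
  · rintro ⟨hS, hmax⟩
    refine ⟨Set.subset_univ S, fun x hx y hy h => hS hx hy h.ne h, fun x _ hx => ?_⟩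
    by_contra! hcon
    refine hx (hmax (insert x S) ?_ (Set.subset_insert x S) (Set.mem_insert x S))
    exact hS.insert fun y hy _ => ⟨hcon y hy, fun h => hcon y hy h.symm⟩

theorem IsWellCovered.isWellCoveredOn_univ [Finite V] (h : G.IsWellCovered) :
    G.IsWellCoveredOn Set.univ := by
  have key : ∀ S : Set V, G.IsMaximalIndepOn Set.univ S → S.ncard = G.indepNum := by
    intro S hS
    rw [isMaximalIndepOn_univ_iff] at hS
    have h1 := h S.toFinite.toFinset (by simpa using hS)
    rw [← maximumIndepSet_card_eq_indepNum _ h1, Set.ncard_eq_toFinset_card S]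
  intro S T hS hT
  rw [key S hS, key T hT]

theorem hasPendantPerfectMatching_of_isWellCovered [Finite V] (hg : G.NoShortCycle)
    (hcomp : ∀ c : G.ConnectedComponent,
      IsEmpty (c.toSimpleGraph ≃g cycleGraph 7) ∧
      IsEmpty (c.toSimpleGraph ≃g (⊤ : SimpleGraph (Fin 1)))) (h : G.IsWellCovered) :
    G.HasPendantPerfectMatching := by
  have hW := h.isWellCoveredOn_univ
  have hpair : ∀ x, ∃ y, G.IsLeafOn Set.univ x y ∨ G.IsLeafOn Set.univ y x := by
    intro x
    rcases hW.isTame hg x trivial with h | ⟨c, hc, -⟩ | h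
    · obtain ⟨C, ⟨e⟩⟩ := exists_iso_fin_one_of_isolated (G := G) (x := x) fun y => h y trivial
      exact ((hcomp C).2.false e).elim
    · obtain ⟨C, ⟨e⟩⟩ := exists_iso_cycleGraph_seven hc
      exact ((hcomp C).1.false e).elim
    · exact h
  let M : G.Subgraph :=
    { verts := Set.univ
      Adj := fun x y => G.IsLeafOn Set.univ x y ∨ G.IsLeafOn Set.univ y x
      adj_sub := by
        rintro x y (h | h)
        exacts [h.2.2.1, h.2.2.1.symm]
      edge_vert := fun _ => trivial
      symm := ⟨fun x y h => h.symm⟩ }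
  refine ⟨M, Subgraph.isPerfectMatching_iff.2 fun x => ?_, ?_⟩
  · obtain ⟨y, hy⟩ := hpair x
    refine ⟨y, hy, ?_⟩
    rintro z hz
    change G.IsLeafOn Set.univ x z ∨ G.IsLeafOn Set.univ z x at hz
    rcases hy with hy | hy
    · rcases hz with hz | hz
      · exact hy.2.2.2 z trivial hz.2.2.1
      · exact hy.2.2.2 z trivial hz.2.2.1.symm
    · rcases hz with hz | hz
      · exact (hz.2.2.2 y trivial hy.2.2.1.symm).symm
      · exact hW.leaf_unique hz hy
  · intro e
    induction e with
    | _ x y =>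
      intro hxy
      refine ⟨M.edgeSet_subset hxy, ?_⟩
      rcases (hxy : G.IsLeafOn Set.univ x y ∨ G.IsLeafOn Set.univ y x) with h | h
      · exact ⟨x, by simp, isPendantVertex_iff.2 ⟨y, h⟩⟩
      · exact ⟨y, by simp, isPendantVertex_iff.2 ⟨x, h⟩⟩

/-! ### Perfect matchings as involutions -/

/-- The involution `p` matches each vertex of `G` with a neighbour. -/
structure IsPairing (G : SimpleGraph V) (p : V → V) : Prop where
  adj : ∀ v, G.Adj v (p v)
  invol : ∀ v, p (p v) = v

theorem Subgraph.IsPerfectMatching.exists_isPairing {M : G.Subgraph} (hM : M.IsPerfectMatching) :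
    ∃ p, G.IsPairing p ∧ ∀ v w, M.Adj v w ↔ p v = w := by
  rw [Subgraph.isPerfectMatching_iff] at hM
  choose p hp huniq using hM
  have h : ∀ v w, M.Adj v w ↔ p v = w :=
    fun v w => ⟨fun h => (huniq v w h).symm, fun h => h ▸ hp v⟩
  exact ⟨p, ⟨fun v => (hp v).adj_sub, fun v => (h _ _).1 (hp v).symm⟩, h⟩

namespace IsPairing

variable {p : V → V}

theorem exists_isPerfectMatching (hp : G.IsPairing p) :
    ∃ M : G.Subgraph, M.IsPerfectMatching ∧ ∀ v w, M.Adj v w ↔ p v = w := by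
  let M : G.Subgraph :=
    { verts := Set.univ
      Adj := fun x y => p x = y
      adj_sub := by
        rintro x y rfl
        exact hp.adj x
      edge_vert := fun _ => trivial
      symm := ⟨by
        rintro x y rfl
        exact hp.invol x⟩ }
  exact ⟨M, Subgraph.isPerfectMatching_iff.2 fun x => ⟨p x, rfl, fun _ h => Eq.symm h⟩,
    fun _ _ => Iff.rfl⟩

theorem injective (hp : G.IsPairing p) : Function.Injective p :=
  Function.LeftInverse.injective hp.invol

theorem card_eq_two_mul [Finite V] (hp : G.IsPairing p) {T : Set V}
    (hT : ∀ v, v ∈ T ↔ p v ∉ T) : Nat.card V = 2 * T.ncard := by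
  have himg : p '' T = Tᶜ := by
    ext v
    constructor
    · rintro ⟨w, hw, rfl⟩
      exact (hT w).1 hw
    · intro hv
      refine ⟨p v, ?_, hp.invol v⟩
      by_contra h
      exact hv ((hT v).2 h)
  have h1 := Set.ncard_image_of_injective T hp.injective
  rw [himg] at h1
  have h2 := Set.ncard_add_ncard_compl T
  omega

end IsPairing

theorem hasPendantPerfectMatching_iff :
    G.HasPendantPerfectMatching ↔ ∃ p, G.IsPairing p ∧
      ∀ v, G.IsLeafOn Set.univ v (p v) ∨ G.IsLeafOn Set.univ (p v) v := by
  have hleaf : ∀ {x y : V}, G.Adj x y → G.IsPendantVertex x → G.IsLeafOn Set.univ x y := by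
    intro x y hxy hx
    obtain ⟨z, hz⟩ := isPendantVertex_iff.1 hx
    rwa [← hz.2.2.2 y trivial hxy] at hz
  constructor
  · rintro ⟨M, hM, hpend⟩
    obtain ⟨p, hp, hpM⟩ := hM.exists_isPairing
    refine ⟨p, hp, fun v => ?_⟩
    obtain ⟨-, w, hw, hw'⟩ := hpend s(v, p v) ((hpM v (p v)).2 rfl)
    rcases Sym2.mem_iff.1 hw with rfl | rfl
    · exact Or.inl (hleaf (hp.adj w) hw')
    · exact Or.inr (hleaf (hp.adj v).symm hw')
  · rintro ⟨p, hp, hpend⟩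
    obtain ⟨M, hM, hpM⟩ := hp.exists_isPerfectMatching
    refine ⟨M, hM, fun e he => ?_⟩
    induction e with
    | _ x y =>
      refine ⟨M.edgeSet_subset he, ?_⟩
      have hxy : p x = y := (hpM x y).1 he
      subst hxy
      rcases hpend x with h | h
      · exact ⟨x, by simp, isPendantVertex_iff.2 ⟨_, h⟩⟩
      · exact ⟨p x, by simp, isPendantVertex_iff.2 ⟨_, h⟩⟩

/-! ### Matchings and stable sets -/

/-- This injection of the matching edges into the complement of `T` gives α + μ ≤ |V|; in the
König–Egerváry case it is onto that complement. -/
theorem Subgraph.IsMatching.exists_endpoint_notMem {M : G.Subgraph} (hM : M.IsMatching)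
    {T : Set V} (hT : G.IsIndepSet T) :
    ∃ r : M.edgeSet → V, Function.Injective r ∧
      ∀ e : M.edgeSet, r e ∈ (e : Sym2 V) ∧ r e ∉ T := by
  have h : ∀ e : M.edgeSet, ∃ v, v ∈ (e : Sym2 V) ∧ v ∉ T := by
    rintro ⟨e, he⟩
    induction e with
    | _ x y =>
      have hxy : M.Adj x y := he
      by_cases hx : x ∈ T
      · exact ⟨y, by simp, fun hy => hT hx hy hxy.ne hxy.adj_sub⟩
      · exact ⟨x, by simp, hx⟩
  choose r hr using h
  refine ⟨r, fun e e' hee => ?_, hr⟩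
  have h1 := (hr e).1
  have h2 := (hr e').1
  rw [← hee] at h2
  obtain ⟨a, ha⟩ := Sym2.mem_iff_exists.1 h1
  obtain ⟨b, hb⟩ := Sym2.mem_iff_exists.1 h2
  apply Subtype.ext
  have h3 := e.2
  have h4 := e'.2
  rw [ha] at h3
  rw [hb] at h4
  have hab : a = b := hM.eq_of_adj_left h3 h4
  rw [ha, hb, hab]

theorem Subgraph.IsMatching.ncard_edgeSet_add_le [Finite V] {M : G.Subgraph} (hM : M.IsMatching)
    {T : Set V} (hT : G.IsIndepSet T) : T.ncard + M.edgeSet.ncard ≤ Nat.card V := by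
  obtain ⟨r, hr, hrT⟩ := hM.exists_endpoint_notMem hT
  have h1 : (Set.range r).ncard = M.edgeSet.ncard := by
    rw [← Set.image_univ, Set.ncard_image_of_injective _ hr, Set.ncard_univ]
    rfl
  have h2 : (Set.range r).ncard ≤ Tᶜ.ncard := Set.ncard_le_ncard (by
    rintro _ ⟨e, rfl⟩
    exact (hrT e).2)
  have h3 := Set.ncard_add_ncard_compl T
  omega

theorem bddAbove_matching [Finite V] (G : SimpleGraph V) :
    BddAbove {n : ℕ | ∃ M : G.Subgraph, M.IsMatching ∧ M.edgeSet.ncard = n} := by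
  refine ⟨Nat.card V, ?_⟩
  rintro n ⟨M, hM, rfl⟩
  have := hM.ncard_edgeSet_add_le (T := ∅) (by simp [IsIndepSet])
  omega

theorem Subgraph.IsMatching.ncard_le_matchingNumber [Finite V] {M : G.Subgraph}
    (hM : M.IsMatching) : M.edgeSet.ncard ≤ G.matchingNumber :=
  le_csSup (bddAbove_matching G) ⟨M, hM, rfl⟩

theorem exists_isMatching_ncard_eq [Finite V] (G : SimpleGraph V) :
    ∃ M : G.Subgraph, M.IsMatching ∧ M.edgeSet.ncard = G.matchingNumber :=
  Nat.sSup_mem (s := {n : ℕ | ∃ M : G.Subgraph, M.IsMatching ∧ M.edgeSet.ncard = n})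
    ⟨_, ⊥, fun _ h => absurd h (by simp), rfl⟩ (bddAbove_matching G)

theorem indepNum_add_matchingNumber_le [Finite V] (G : SimpleGraph V) :
    G.indepNum + G.matchingNumber ≤ Nat.card V := by
  obtain ⟨M, hM, h⟩ := exists_isMatching_ncard_eq G
  obtain ⟨T, hT⟩ := maximumIndepSet_exists (G := G)
  have := hM.ncard_edgeSet_add_le hT.isIndepSet
  rwa [Set.ncard_coe_finset, maximumIndepSet_card_eq_indepNum T hT, h] at this

theorem IsKonigEgervary.exists_isMatching [Finite V] (h : G.IsKonigEgervary) :
    ∃ M : G.Subgraph, M.IsMatching ∧ ∀ T : Finset V, G.IsMaximumIndepSet T →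
      (∀ v ∉ T, v ∈ M.verts) ∧ ∀ a b, M.Adj a b → a ∉ T → b ∈ T := by
  obtain ⟨M, hM, hcard⟩ := exists_isMatching_ncard_eq G
  refine ⟨M, hM, fun T hT => ?_⟩
  obtain ⟨r, hr, hrT⟩ := hM.exists_endpoint_notMem hT.isIndepSet
  have h1 : (Set.range r).ncard = M.edgeSet.ncard := by
    rw [← Set.image_univ, Set.ncard_image_of_injective _ hr, Set.ncard_univ]
    rfl
  have h2 := maximumIndepSet_card_eq_indepNum T hT
  have h3 := Set.ncard_add_ncard_compl (T : Set V)
  rw [Set.ncard_coe_finset] at h3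
  have hrange : Set.range r = (T : Set V)ᶜ := by
    refine Set.eq_of_subset_of_ncard_le ?_ ?_
    · rintro _ ⟨e, rfl⟩
      exact (hrT e).2
    · rw [IsKonigEgervary] at h
      omega
  have hsurj : ∀ v, v ∉ T → ∃ w, ∃ hvw : M.Adj v w, r ⟨s(v, w), hvw⟩ = v := by
    intro v hv
    have : v ∈ Set.range r := by
      rw [hrange]
      exact hv
    obtain ⟨e, he⟩ := this
    have hve := (hrT e).1
    rw [he] at hve
    obtain ⟨w, hw⟩ := Sym2.mem_iff_exists.1 hve
    have hvw := e.2
    rw [hw] at hvw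
    refine ⟨w, hvw, ?_⟩
    exact (congrArg r (Subtype.ext hw.symm)).trans he
  refine ⟨fun v hv => ?_, fun a b hab ha => ?_⟩
  · obtain ⟨w, hvw, -⟩ := hsurj v hv
    exact M.edge_vert hvw
  -- With both ends outside `T`, each would have to be the one endpoint that `r` selects.
  · by_contra hb
    obtain ⟨w, haw, hra⟩ := hsurj a ha
    obtain ⟨w', hbw', hrb⟩ := hsurj b hb
    obtain rfl := hM.eq_of_adj_left hab haw
    obtain rfl := hM.eq_of_adj_left hab.symm hbw'
    exact hab.ne (hra.symm.trans ((congrArg r (Subtype.ext Sym2.eq_swap)).trans hrb))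

theorem IsMaximumIndepSet.not_adj [Finite V] {T : Finset V} (hT : G.IsMaximumIndepSet T) {a b : V}
    (ha : a ∈ T) (hb : b ∈ T) : ¬ G.Adj a b :=
  fun h => hT.isIndepSet ha hb h.ne h

/-- A König–Egerváry graph has a perfect matching as soon as the vertices which are missed by
some matching of maximum size can be avoided by maximum stable sets. -/
theorem IsKonigEgervary.exists_isPairing [Finite V] (h : G.IsKonigEgervary)
    (hv : ∀ M : G.Subgraph, (∀ T : Finset V, G.IsMaximumIndepSet T →
      (∀ v ∉ T, v ∈ M.verts) ∧ ∀ a b, M.Adj a b → a ∉ T → b ∈ T) → M.IsMatching → M.IsSpanning) :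
    ∃ p, G.IsPairing p ∧ ∀ T : Finset V, G.IsMaximumIndepSet T → ∀ v, v ∈ T ↔ p v ∉ T := by
  obtain ⟨M, hM, hT⟩ := h.exists_isMatching
  obtain ⟨p, hp, hpM⟩ := Subgraph.IsPerfectMatching.exists_isPairing ⟨hM, hv M hT hM⟩
  refine ⟨p, hp, fun T hTm v => ⟨fun hv hpv => hTm.not_adj hv hpv (hp.adj v), fun hpv => ?_⟩⟩
  exact (hT T hTm).2 (p v) v ((hpM v (p v)).2 rfl).symm hpv

/-! ### Consequences of a perfect matching by pendant edges -/

section Pendant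

variable {p : V → V}

/-- If `S` missed both ends of a pair, nothing in `S` could dominate its pendant end. -/
theorem IsPairing.mem_iff_of_isMaximalIndepOn (hp : G.IsPairing p)
    (hl : ∀ v, G.IsLeafOn Set.univ v (p v) ∨ G.IsLeafOn Set.univ (p v) v) {S : Set V}
    (hS : G.IsMaximalIndepOn Set.univ S) (v : V) : v ∈ S ↔ p v ∉ S := by
  refine ⟨fun h h' => hS.2.1 v h _ h' (hp.adj v), fun h => ?_⟩
  by_contra hv
  rcases hl v with hl | hl
  · obtain ⟨y, hy, hvy⟩ := hS.2.2 v trivial hv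
    exact h (hl.2.2.2 y trivial hvy ▸ hy)
  · obtain ⟨y, hy, hvy⟩ := hS.2.2 (p v) trivial h
    exact hv (hl.2.2.2 y trivial hvy ▸ hy)

theorem IsMaximumIndepSet.isMaximalIndepOn_univ [Finite V] {T : Finset V}
    (hT : G.IsMaximumIndepSet T) : G.IsMaximalIndepOn Set.univ (T : Set V) := by
  have := Fintype.ofFinite V
  exact isMaximalIndepOn_univ_iff.2 hT.isMaximalIndepSet

theorem IsPairing.isVeryWellCovered [Finite V] (hp : G.IsPairing p)
    (hl : ∀ v, G.IsLeafOn Set.univ v (p v) ∨ G.IsLeafOn Set.univ (p v) v) :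
    G.IsVeryWellCovered := by
  obtain ⟨T, hT⟩ := maximumIndepSet_exists (G := G)
  have h1 := hp.card_eq_two_mul (hp.mem_iff_of_isMaximalIndepOn hl hT.isMaximalIndepOn_univ)
  rw [Set.ncard_coe_finset] at h1
  constructor
  · intro S hS
    have h2 := hp.card_eq_two_mul
      (hp.mem_iff_of_isMaximalIndepOn hl (isMaximalIndepOn_univ_iff.2 hS))
    rw [Set.ncard_coe_finset] at h2
    refine ⟨hS.prop, fun t ht => ?_⟩
    have := hT.maximum t ht
    omega
  · rw [h1, maximumIndepSet_card_eq_indepNum T hT]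

theorem IsPairing.isKonigEgervary [Finite V] (hp : G.IsPairing p)
    (hcard : Nat.card V = 2 * G.indepNum) : G.IsKonigEgervary := by
  obtain ⟨M, hM, hpM⟩ := hp.exists_isPerfectMatching
  obtain ⟨T, hT⟩ := maximumIndepSet_exists (G := G)
  have h1 : (T : Set V).ncard ≤ M.edgeSet.ncard := by
    refine Set.ncard_le_ncard_of_injOn (fun v => s(v, p v)) (fun v _ => (hpM v (p v)).2 rfl) ?_
    intro v hv w hw hvw
    rcases Sym2.eq_iff.1 hvw with h | h
    · exact h.1
    · exact absurd (h.1 ▸ (hp.adj w).symm) (hT.not_adj hv hw)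
  rw [Set.ncard_coe_finset, maximumIndepSet_card_eq_indepNum T hT] at h1
  have h2 := hM.1.ncard_le_matchingNumber
  have h3 := indepNum_add_matchingNumber_le G
  rw [IsKonigEgervary]
  omega

end Pendant

/-! ### Stability under added edges -/

theorem indepNum_sup_fromEdgeSet_eq_iff [Finite V] {e₁ e₂ : Sym2 V} (h₁ : e₁ ∈ Gᶜ.edgeSet)
    (h₂ : e₂ ∈ Gᶜ.edgeSet) :
    (G ⊔ fromEdgeSet {e₁, e₂}).indepNum = G.indepNum ↔
      ∃ T : Finset V, G.IsMaximumIndepSet T ∧ (∃ v ∈ e₁, v ∉ T) ∧ ∃ v ∈ e₂, v ∉ T := by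
  have hadj : ∀ {a b}, (G ⊔ fromEdgeSet {e₁, e₂}).Adj a b ↔
      G.Adj a b ∨ (s(a, b) = e₁ ∨ s(a, b) = e₂) ∧ a ≠ b := by simp
  obtain ⟨T, hT⟩ := (G ⊔ fromEdgeSet {e₁, e₂}).exists_isNIndepSet_indepNum
  have hTG : G.IsIndepSet T := fun a ha b hb hab h => hT.1 ha hb hab (hadj.2 (Or.inl h))
  constructor
  · intro h
    refine ⟨T, ⟨hTG, fun t ht => ?_⟩, ?_, ?_⟩
    · rw [hT.2, h]
      exact ht.card_le_indepNum
    · by_contra! hcon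
      induction e₁ with
      | _ a b =>
        have hab : a ≠ b := ((mem_edgeSet _).1 h₁).ne
        exact hT.1 (hcon a (by simp)) (hcon b (by simp)) hab (hadj.2 (Or.inr ⟨Or.inl rfl, hab⟩))
    · by_contra! hcon
      induction e₂ with
      | _ a b =>
        have hab : a ≠ b := ((mem_edgeSet _).1 h₂).ne
        exact hT.1 (hcon a (by simp)) (hcon b (by simp)) hab (hadj.2 (Or.inr ⟨Or.inr rfl, hab⟩))
  · rintro ⟨S, hS, ⟨v, hv, hvS⟩, w, hw, hwS⟩
    have h1 := hTG.card_le_indepNum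
    rw [hT.2] at h1
    refine le_antisymm h1 ?_
    rw [← maximumIndepSet_card_eq_indepNum S hS]
    refine IsIndepSet.card_le_indepNum fun a ha b hb hab h => ?_
    have key : ∀ x ∈ s(a, b), x ∈ S := by
      intro x hx
      rcases Sym2.mem_iff.1 hx with rfl | rfl
      exacts [ha, hb]
    rcases hadj.1 h with h | ⟨rfl | rfl, -⟩
    · exact hS.not_adj ha hb h
    · exact hvS (key v hv)
    · exact hwS (key w hw)

theorem isAlphaZeroPlusStable_iff [Finite V] :
    G.IsAlphaZeroPlusStable ↔ ∀ v, ∃ T : Finset V, G.IsMaximumIndepSet T ∧ v ∉ T := by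
  rw [IsAlphaZeroPlusStable, xi, Set.ncard_eq_zero, Set.eq_empty_iff_forall_notMem]
  simp

theorem IsAlphaPlusPlusStable.exists_of_not_adj [Finite V] (h : G.IsAlphaPlusPlusStable)
    {a b c d : V} (hab : a ≠ b) (hab' : ¬ G.Adj a b) (hcd : c ≠ d) (hcd' : ¬ G.Adj c d) :
    ∃ T : Finset V, G.IsMaximumIndepSet T ∧ ¬ (a ∈ T ∧ b ∈ T) ∧ ¬ (c ∈ T ∧ d ∈ T) := by
  have h₁ : s(a, b) ∈ Gᶜ.edgeSet := by simp [hab, hab']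
  have h₂ : s(c, d) ∈ Gᶜ.edgeSet := by simp [hcd, hcd']
  obtain ⟨T, hT, h3, h4⟩ := (indepNum_sup_fromEdgeSet_eq_iff h₁ h₂).1 (h _ h₁ _ h₂)
  refine ⟨T, hT, ?_, ?_⟩
  · rintro ⟨ha, hb⟩
    obtain ⟨x, hx, hxT⟩ := h3
    rcases Sym2.mem_iff.1 hx with rfl | rfl
    exacts [hxT ha, hxT hb]
  · rintro ⟨ha, hb⟩
    obtain ⟨x, hx, hxT⟩ := h4
    rcases Sym2.mem_iff.1 hx with rfl | rfl
    exacts [hxT ha, hxT hb]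

theorem hasPendantPerfectMatching_of_isAlphaPlusPlusStable [Finite V] (hg : G.NoShortCycle)
    (hiso : ∀ v, ∃ w, G.Adj v w) (hKE : G.IsKonigEgervary) (hα : G.IsAlphaPlusPlusStable) :
    G.HasPendantPerfectMatching := by
  obtain ⟨p, hp, hT⟩ := hKE.exists_isPairing (by
    intro M hM hMm v
    -- An unmatched `v` lies in all maximum stable sets, and so does the partner `t` of any
    -- neighbour of `v`; adding the edge `vt` would lower α.
    by_contra hv
    have hvT : ∀ T : Finset V, G.IsMaximumIndepSet T → v ∈ T := by
      intro T hT
      by_contra h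
      exact hv ((hM T hT).1 v h)
    obtain ⟨w, hvw⟩ := hiso v
    have hwT : ∀ T : Finset V, G.IsMaximumIndepSet T → w ∉ T :=
      fun T hT hw => hT.not_adj (hvT T hT) hw hvw
    obtain ⟨T₀, hT₀⟩ := maximumIndepSet_exists (G := G)
    obtain ⟨t, hwt, -⟩ := hMm ((hM T₀ hT₀).1 w (hwT T₀ hT₀))
    have htT : ∀ T : Finset V, G.IsMaximumIndepSet T → t ∈ T :=
      fun T hT => (hM T hT).2 w t hwt (hwT T hT)
    have hvt : v ≠ t := by
      rintro rfl
      exact hv hwt.snd_mem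
    have hvt' := hT₀.not_adj (hvT T₀ hT₀) (htT T₀ hT₀)
    obtain ⟨T, hT, h, -⟩ := hα.exists_of_not_adj hvt hvt' hvt hvt'
    exact h ⟨hvT T hT, htT T hT⟩)
  refine hasPendantPerfectMatching_iff.2 ⟨p, hp, fun v => ?_⟩
  by_contra! hcon
  have key : ∀ a, ¬ G.IsLeafOn Set.univ a (p a) → ∃ c, G.Adj a c ∧ c ≠ p a ∧
      p a ≠ p c ∧ a ≠ p c ∧ ¬ G.Adj a (p c) := by
    intro a ha
    have : ∃ c, G.Adj a c ∧ c ≠ p a := by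
      by_contra! h
      exact ha ⟨trivial, trivial, hp.adj a, fun z _ => h z⟩
    obtain ⟨c, hac, hc⟩ := this
    refine ⟨c, hac, hc, fun h => hac.ne (hp.injective h), ?_, fun h => hg.no3 hac (hp.adj c) h.symm⟩
    rintro rfl
    exact hc (hp.invol c).symm
  obtain ⟨c, hvc, -, -, h1, h2⟩ := key v hcon.1
  obtain ⟨d, hvd, -, -, h3, h4⟩ := key (p v) (by rw [hp.invol]; exact hcon.2)
  -- If `v ∈ T` then `c ∉ T`, so `p c ∈ T`; otherwise `p v ∈ T` and likewise `p d ∈ T`. Either way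
  -- `T` contains one of the two non-edges.
  obtain ⟨T, hTm, h5, h6⟩ := hα.exists_of_not_adj h1 h2 h3 h4
  have hmem : ∀ {x y}, x ∈ T → G.Adj x y → p y ∈ T := by
    intro x y hx hxy
    rw [hT T hTm, hp.invol]
    exact fun hy => hTm.not_adj hx hy hxy
  by_cases hv : v ∈ T
  · exact h5 ⟨hv, hmem hv hvc⟩
  · have hv' : p v ∈ T := by rw [hT T hTm, hp.invol]; exact hv
    exact h6 ⟨hv', hmem hv' hvd⟩

section Pendant

variable {p : V → V}

/-- Swapping some of the chosen pendant vertices with their partners. -/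
theorem IsPairing.exists_isMaximumIndepSet_swap [Finite V] (hp : G.IsPairing p)
    (hcard : Nat.card V = 2 * G.indepNum) {X B : Set V}
    (hX : ∀ v, v ∈ X ↔ p v ∉ X) (hXl : ∀ v ∈ X, G.IsLeafOn Set.univ v (p v))
    (hBX : ∀ v ∈ B, v ∉ X) (hB : ∀ x ∈ B, ∀ y ∈ B, ¬ G.Adj x y) :
    ∃ T : Finset V, G.IsMaximumIndepSet T ∧ ∀ v, v ∈ T ↔ v ∈ X ∧ p v ∉ B ∨ v ∈ B := by
  set T : Set V := {v | v ∈ X ∧ p v ∉ B ∨ v ∈ B} with hTdef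
  have hTp : ∀ v, v ∈ T ↔ p v ∉ T := by
    intro v
    simp only [hTdef, Set.mem_ofPred_eq, hp.invol]
    have h1 := hX v
    have h2 := hBX v
    have h3 := hBX (p v)
    tauto
  have hTi : G.IsIndepSet T := by
    rintro x hx y hy - hxy
    have hleaf : ∀ {x y}, x ∈ X ∧ p x ∉ B → y ∈ T → ¬ G.Adj x y := by
      intro x y hx hy hxy
      have := (hXl x hx.1).2.2.2 y trivial hxy
      subst this
      refine (hTp x).1 (Or.inl hx) hy
    rcases hx with hx | hx
    · exact hleaf hx hy hxy
    · rcases hy with hy | hy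
      · exact hleaf hy (Or.inr hx) hxy.symm
      · exact hB x hx y hy hxy
  have hTc := hp.card_eq_two_mul hTp
  refine ⟨T.toFinite.toFinset, ⟨by simpa using hTi, fun t ht => ?_⟩, fun v => by simp [hTdef]⟩
  rw [← Set.ncard_eq_toFinset_card T]
  have := ht.card_le_indepNum
  omega

theorem IsPairing.isAlphaPlusPlusStable [Finite V] (hg : G.NoShortCycle) (hp : G.IsPairing p)
    (hl : ∀ v, G.IsLeafOn Set.univ v (p v) ∨ G.IsLeafOn Set.univ (p v) v)
    (hcard : Nat.card V = 2 * G.indepNum) : G.IsAlphaPlusPlusStable := by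
  -- Choosing on unordered pairs selects a single end even when both are pendant; the value off the
  -- matching is arbitrary.
  have hrep : ∀ e : Sym2 V, ∃ v, ∀ w, e = s(w, p w) → v ∈ e ∧ G.IsLeafOn Set.univ v (p v) := by
    intro e
    by_cases he : ∃ w, e = s(w, p w)
    · obtain ⟨w, rfl⟩ := he
      rcases hl w with h | h
      · exact ⟨w, fun _ _ => ⟨by simp, h⟩⟩
      · exact ⟨p w, fun _ _ => ⟨by simp, by rwa [hp.invol]⟩⟩
    · exact ⟨e.out.1, fun w hw => absurd ⟨w, hw⟩ he⟩
  choose r hr using hrep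
  set X : Set V := {v | r s(v, p v) = v} with hXdef
  have hX : ∀ v, v ∈ X ↔ p v ∉ X := by
    intro v
    have h1 := (hr s(v, p v) v rfl).1
    have h2 := (hp.adj v).ne
    simp only [hXdef, Set.mem_ofPred_eq, hp.invol]
    rw [Sym2.eq_swap (a := p v)]
    rcases Sym2.mem_iff.1 h1 with h | h <;> simp [h, h2, h2.symm]
  have hXl : ∀ v ∈ X, G.IsLeafOn Set.univ v (p v) := by
    intro v hv
    have := (hr s(v, p v) v rfl).2
    rwa [show r s(v, p v) = v from hv] at this
  have hpX : ∀ v ∈ X, p v ∉ X := fun v => (hX v).1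
  have hswap := fun B hBX hB => hp.exists_isMaximumIndepSet_swap hcard (B := B) hX hXl hBX hB
  intro e₁ h₁ e₂ h₂
  rw [indepNum_sup_fromEdgeSet_eq_iff h₁ h₂]
  have main : ∀ e₁ ∈ Gᶜ.edgeSet, ∀ e₂ ∈ Gᶜ.edgeSet, (∀ v ∈ e₁, v ∈ X) →
      ∃ T : Finset V, G.IsMaximumIndepSet T ∧ (∃ v ∈ e₁, v ∉ T) ∧ ∃ v ∈ e₂, v ∉ T := by
    intro e₁ h₁ e₂ h₂ heX
    induction e₁ with
    | _ a b =>
    have hab : a ≠ b := ((mem_edgeSet _).1 h₁).ne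
    have ha : a ∈ X := heX a (by simp)
    have hb : b ∈ X := heX b (by simp)
    obtain ⟨S, hS, hS'⟩ := hswap {p a} (by simpa using hpX a ha) (by simp)
    obtain ⟨T, hT, hT'⟩ := hswap {p b} (by simpa using hpX b hb) (by simp)
    have haS : a ∉ S := by
      rw [hS']; simp [(hp.adj a).ne]
    have hbT : b ∉ T := by
      rw [hT']; simp [(hp.adj b).ne]
    -- If both swaps contain e₂, its ends are in `X` and differ from `a` and `b`. Swapping one end
    -- of each non-edge then works unless the partners are adjacent; if all four choices fail, the
    -- partners form a 4-cycle.
    by_cases heS : ∃ v ∈ e₂, v ∉ S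
    · exact ⟨S, hS, ⟨a, by simp, haS⟩, heS⟩
    by_cases heT : ∃ v ∈ e₂, v ∉ T
    · exact ⟨T, hT, ⟨b, by simp, hbT⟩, heT⟩
    push Not at heS heT
    induction e₂ with
    | _ c d =>
    have hcd : c ≠ d := ((mem_edgeSet _).1 h₂).ne
    have hmem : ∀ v ∈ s(c, d), v ∈ X ∧ v ≠ a ∧ v ≠ b := by
      intro v hv
      have h1 := heS v hv
      have h2 := heT v hv
      refine ⟨?_, ?_, ?_⟩
      · rw [hS'] at h1
        rw [hT'] at h2
        rcases h1 with h1 | h1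
        · exact h1.1
        · rcases h2 with h2 | h2
          · exact h2.1
          · exact absurd (hp.injective (h1.symm.trans h2)) hab
      · rintro rfl
        exact haS h1
      · rintro rfl
        exact hbT h2
    obtain ⟨hc, hca, hcb⟩ := hmem c (by simp)
    obtain ⟨hd, hda, hdb⟩ := hmem d (by simp)
    have hpair : ∀ x ∈ s(a, b), ∀ y ∈ s(c, d), x ∈ X → y ∈ X → ¬ G.Adj (p x) (p y) →
        ∃ T : Finset V, G.IsMaximumIndepSet T ∧ (∃ v ∈ s(a, b), v ∉ T) ∧ ∃ v ∈ s(c, d), v ∉ T := by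
      intro x hx y hy hxX hyX hxy
      obtain ⟨R, hR, hR'⟩ := hswap {p x, p y} (by simp [hpX x hxX, hpX y hyX])
        (by simp [hxy, G.adj_comm (p y) (p x)])
      refine ⟨R, hR, ⟨x, hx, ?_⟩, ⟨y, hy, ?_⟩⟩
      · rw [hR']
        rintro (h | h | h)
        · exact h.2 (Or.inl rfl)
        · exact (hp.adj x).ne h
        · exact hpX y hyX (h ▸ hxX)
      · rw [hR']
        rintro (h | h | h)
        · exact h.2 (Or.inr rfl)
        · exact hpX x hxX (h ▸ hyX)
        · exact (hp.adj y).ne h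
    by_contra hno
    have hall : ∀ x ∈ s(a, b), ∀ y ∈ s(c, d), x ∈ X → y ∈ X → G.Adj (p x) (p y) := by
      intro x hx y hy hxX hyX
      by_contra hxy
      exact hno (hpair x hx y hy hxX hyX hxy)
    exact hg.no4 (hall a (by simp) c (by simp) ha hc) (hall b (by simp) c (by simp) hb hc).symm
      (hall b (by simp) d (by simp) hb hd) (hall a (by simp) d (by simp) ha hd).symm
      (fun h => hab (hp.injective h)) (fun h => hcd (hp.injective h))
  by_cases he₁ : ∀ v ∈ e₁, v ∈ X
  · exact main e₁ h₁ e₂ h₂ he₁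
  by_cases he₂ : ∀ v ∈ e₂, v ∈ X
  · obtain ⟨T, hT, h3, h4⟩ := main e₂ h₂ e₁ h₁ he₂
    exact ⟨T, hT, h4, h3⟩
  push Not at he₁ he₂
  obtain ⟨T, hT, hT'⟩ := hswap ∅ (by simp) (by simp)
  replace hT' : ∀ v, v ∈ T ↔ v ∈ X := by simpa using hT'
  simp only [← hT'] at he₁ he₂
  exact ⟨T, hT, he₁, he₂⟩

theorem IsWellCovered.isAlphaZeroPlusStable [Finite V] (h : G.IsWellCovered)
    (hiso : ∀ v, ∃ w, G.Adj v w) : G.IsAlphaZeroPlusStable := by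
  rw [isAlphaZeroPlusStable_iff]
  intro v
  obtain ⟨w, hvw⟩ := hiso v
  obtain ⟨S, hwS, hS⟩ := exists_isMaximalIndepOn (G := G) (Set.subset_univ {w}) (by simp)
  refine ⟨S.toFinite.toFinset, h _ (by simpa using isMaximalIndepOn_univ_iff.1 hS), ?_⟩
  simp only [Set.Finite.mem_toFinset]
  exact fun hv => hS.2.1 v hv w (hwS rfl) hvw

/-- Without components isomorphic to `K₂`, no two partners are both pendant. -/
theorem IsPairing.not_isPendantVertex (hp : G.IsPairing p)
    (hK2 : ∀ c : G.ConnectedComponent,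
      IsEmpty (c.toSimpleGraph ≃g (⊤ : SimpleGraph (Fin 2)))) {v : V}
    (hv : G.IsPendantVertex v) : ¬ G.IsPendantVertex (p v) := by
  intro hpv
  obtain ⟨y, hy⟩ := isPendantVertex_iff.1 hv
  obtain ⟨z, hz⟩ := isPendantVertex_iff.1 hpv
  rw [← hy.2.2.2 _ trivial (hp.adj v)] at hy
  rw [← hz.2.2.2 _ trivial (hp.adj v).symm] at hz
  obtain ⟨c, ⟨e⟩⟩ := exists_iso_fin_two hy hz
  exact (hK2 c).false e

theorem IsPairing.ncard_isPendantVertex [Finite V] (hp : G.IsPairing p)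
    (hl : ∀ v, G.IsLeafOn Set.univ v (p v) ∨ G.IsLeafOn Set.univ (p v) v)
    (hcard : Nat.card V = 2 * G.indepNum)
    (hK2 : ∀ c : G.ConnectedComponent,
      IsEmpty (c.toSimpleGraph ≃g (⊤ : SimpleGraph (Fin 2)))) :
    {v : V | G.IsPendantVertex v}.ncard = G.indepNum := by
  have := hp.card_eq_two_mul (T := {v : V | G.IsPendantVertex v}) fun v => by
    refine ⟨fun h => hp.not_isPendantVertex hK2 h, fun h => ?_⟩
    rcases hl v with hl | hl
    · exact isPendantVertex_iff.2 ⟨_, hl⟩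
    · exact absurd (isPendantVertex_iff.2 ⟨_, hl⟩) h
  omega

end Pendant

theorem hasPendantPerfectMatching_of_isAlphaZeroPlusStable [Finite V]
    (hKE : G.IsKonigEgervary) (hα : G.IsAlphaZeroPlusStable)
    (hcard : {v : V | G.IsPendantVertex v}.ncard = G.indepNum)
    (hK2 : ∀ c : G.ConnectedComponent,
      IsEmpty (c.toSimpleGraph ≃g (⊤ : SimpleGraph (Fin 2)))) :
    G.HasPendantPerfectMatching := by
  rw [isAlphaZeroPlusStable_iff] at hα
  obtain ⟨p, hp, hT⟩ := hKE.exists_isPairing (by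
    intro M hM _ v
    obtain ⟨T, hT, hv⟩ := hα v
    exact (hM T hT).1 v hv)
  obtain ⟨T, hTm⟩ := maximumIndepSet_exists (G := G)
  have h1 := hp.card_eq_two_mul (T := (T : Set V)) (hT T hTm)
  rw [Set.ncard_coe_finset, maximumIndepSet_card_eq_indepNum T hTm] at h1
  set P : Set V := {v : V | G.IsPendantVertex v} with hP
  have h2 := Set.ncard_image_of_injective P hp.injective
  have h3 := Set.ncard_add_ncard_compl P
  -- Partners are never both pendant and `P` has half of the vertices, so each pair has exactly one
  -- pendant end.
  have himg : p '' P = Pᶜ := by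
    refine Set.eq_of_subset_of_ncard_le ?_ (by omega)
    rintro _ ⟨v, hv, rfl⟩
    exact hp.not_isPendantVertex hK2 hv
  have hleaf : ∀ v ∈ P, G.IsLeafOn Set.univ v (p v) := by
    intro v hv
    obtain ⟨y, hy⟩ := isPendantVertex_iff.1 hv
    rwa [← hy.2.2.2 _ trivial (hp.adj v)] at hy
  refine hasPendantPerfectMatching_iff.2 ⟨p, hp, fun v => ?_⟩
  by_cases hv : v ∈ P
  · exact Or.inl (hleaf v hv)
  · rw [← Set.mem_compl_iff, ← himg] at hv
    obtain ⟨w, hw, rfl⟩ := hv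
    rw [hp.invol]
    exact Or.inr (hleaf w hw)

/-- If the complement of `G` has at most one edge, then adding it twice is harmless. -/
theorem IsAlphaPlusPlusStableDistinct.isAlphaPlusPlusStable [Finite V] (hg : G.NoShortCycle)
    (hiso : ∀ v, ∃ w, G.Adj v w) (hP3 : IsEmpty (G ≃g pathGraph 3))
    (h : G.IsAlphaPlusPlusStableDistinct) : G.IsAlphaPlusPlusStable := by
  intro e₁ h₁ e₂ h₂
  by_cases hne : e₁ = e₂
  swap
  · exact h e₁ h₁ e₂ h₂ hne
  subst hne
  by_cases hex : ∃ e ∈ Gᶜ.edgeSet, e₁ ≠ e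
  · obtain ⟨e, he, hne⟩ := hex
    obtain ⟨T, hT, h3, -⟩ := (indepNum_sup_fromEdgeSet_eq_iff h₁ he).1 (h e₁ h₁ e he hne)
    exact (indepNum_sup_fromEdgeSet_eq_iff h₁ h₁).2 ⟨T, hT, h3, h3⟩
  exfalso
  push Not at hex
  induction e₁ with
  | _ a b =>
  obtain ⟨hab, hab'⟩ : a ≠ b ∧ ¬ G.Adj a b := by simpa using h₁
  have hadj : ∀ x y, x ≠ y → ¬ G.Adj x y → s(a, b) = s(x, y) :=
    fun x y hxy hxy' => hex _ (by simp [hxy, hxy'])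
  obtain ⟨c, hac⟩ := hiso a
  have hcb : c ≠ b := by
    rintro rfl
    exact hab' hac
  have hbc : G.Adj c b := by
    by_contra hcon
    have := hadj c b hcb hcon
    simp [hac.ne, hab] at this
  -- As `ab` is the only non-edge, a fourth vertex would form a triangle with `a` and `c`.
  have hall : ∀ d, d = a ∨ d = c ∨ d = b := by
    intro d
    by_contra! hd
    have h1 : G.Adj a d := by
      by_contra hcon
      have := hadj a d (Ne.symm hd.1) hcon
      simp [hd.2.2.symm] at this
      exact hd.1 this.1.symm
    have h2 : G.Adj c d := by
      by_contra hcon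
      have := hadj c d (Ne.symm hd.2.1) hcon
      simp [hac.ne] at this
      exact hd.1 this.1.symm
    exact hg.no3 hac h2 h1.symm
  refine hP3.false (Iso.symm ⟨Equiv.ofBijective ![a, c, b] ⟨?_, ?_⟩, ?_⟩)
  · intro i j
    have := hac.ne
    fin_cases i <;> fin_cases j <;> simp [*, Ne.symm, hab.symm, hcb.symm, this.symm]
  · intro d
    rcases hall d with rfl | rfl | rfl
    exacts [⟨0, rfl⟩, ⟨1, rfl⟩, ⟨2, rfl⟩]
  · intro i j
    have hba' : ¬ G.Adj b a := fun h => hab' h.symm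
    change G.Adj (![a, c, b] i) (![a, c, b] j) ↔ _
    fin_cases i <;> fin_cases j <;>
      simp [pathGraph_adj, hac, hbc, hab', hba', hac.symm, hbc.symm]

end SimpleGraph

theorem proposition3p9 {V : Type*} [Finite V] (G : SimpleGraph V)
    (hgirth : 6 ≤ G.egirth)
    (hcomp : ∀ c : G.ConnectedComponent,
      IsEmpty (c.toSimpleGraph ≃g SimpleGraph.cycleGraph 7) ∧
      IsEmpty (c.toSimpleGraph ≃g (⊤ : SimpleGraph (Fin 1)))) :
    List.TFAE
      [G.IsWellCovered,
       G.HasPendantPerfectMatching,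
       G.IsVeryWellCovered,
       G.IsKonigEgervary ∧ G.IsAlphaPlusPlusStable] ∧
    ((∀ c : G.ConnectedComponent,
        IsEmpty (c.toSimpleGraph ≃g (⊤ : SimpleGraph (Fin 2)))) →
      (G.IsWellCovered ↔
        G.IsKonigEgervary ∧ G.IsAlphaZeroPlusStable ∧
          {v : V | G.IsPendantVertex v}.ncard = G.indepNum)) ∧
    (IsEmpty (G ≃g SimpleGraph.pathGraph 3) →
      (G.IsWellCovered ↔ G.IsKonigEgervary ∧ G.IsAlphaPlusPlusStableDistinct)) := by
  have hg := SimpleGraph.noShortCycle_of_egirth hgirth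
  have hiso : ∀ v, ∃ w, G.Adj v w := by
    intro v
    by_contra! h
    obtain ⟨c, ⟨e⟩⟩ := SimpleGraph.exists_iso_fin_one_of_isolated h
    exact (hcomp c).2.false e
  have h12 : G.IsWellCovered → G.HasPendantPerfectMatching :=
    SimpleGraph.hasPendantPerfectMatching_of_isWellCovered hg hcomp
  have h23 : G.HasPendantPerfectMatching → G.IsVeryWellCovered := by
    intro h
    obtain ⟨p, hp, hl⟩ := SimpleGraph.hasPendantPerfectMatching_iff.1 h
    exact hp.isVeryWellCovered hl
  have h24 : G.HasPendantPerfectMatching → G.IsKonigEgervary ∧ G.IsAlphaPlusPlusStable := by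
    intro h
    obtain ⟨p, hp, hl⟩ := SimpleGraph.hasPendantPerfectMatching_iff.1 h
    exact ⟨hp.isKonigEgervary (h23 h).2, hp.isAlphaPlusPlusStable hg hl (h23 h).2⟩
  have h42 : G.IsKonigEgervary ∧ G.IsAlphaPlusPlusStable → G.HasPendantPerfectMatching :=
    fun h => SimpleGraph.hasPendantPerfectMatching_of_isAlphaPlusPlusStable hg hiso h.1 h.2
  refine ⟨?_, fun hK2 => ⟨fun h => ?_, fun h => ?_⟩, fun hP3 => ⟨fun h => ?_, fun h => ?_⟩⟩
  · tfae_have 1 → 2 := h12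
    tfae_have 2 → 3 := h23
    tfae_have 3 → 1 := fun h => h.1
    tfae_have 2 → 4 := h24
    tfae_have 4 → 2 := h42
    tfae_finish
  · obtain ⟨p, hp, hl⟩ := SimpleGraph.hasPendantPerfectMatching_iff.1 (h12 h)
    have hcard := (h23 (h12 h)).2
    exact ⟨hp.isKonigEgervary hcard, h.isAlphaZeroPlusStable hiso,
      hp.ncard_isPendantVertex hl hcard hK2⟩
  · exact (h23 (SimpleGraph.hasPendantPerfectMatching_of_isAlphaZeroPlusStable h.1 h.2.1 h.2.2 hK2)).1
  · have h4 := h24 (h12 h)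
    exact ⟨h4.1, fun e₁ h₁ e₂ h₂ _ => h4.2 e₁ h₁ e₂ h₂⟩
  · exact (h23 (h42 ⟨h.1, h.2.isAlphaPlusPlusStable hg hiso hP3⟩)).1
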